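/- We work in the category of all topological spaces. Let $D^n$ ($n\ge 0$) be the closed unit disk in $\mathbb{R}^n$, $S^{n-1}$ its boundary ($S^{-1}=\emptyset$), $I_0=[0,1]$, and let $J=\{D^n\times\{0\}\hookrightarrow D^n\times I_0 \mid n\ge 0\}$. For a continuous map $f\colon X\to Y$ put $W_0=X$, $q_0=f$, and, given $q_k\colon W_k\to Y$, let $W_{k+1}$ be the pushout of $$\coprod D^n\times I_0 \longleftarrow \coprod D^n\times\{0\}\longrightarrow W_k ,$$ with one summand for each $n\ge 0$ and each commutative square consisting of maps $D^n\times\{0\}\to W_k$ and $D^n\times I_0\to Y$ that agree in $Y$ on $D^n\times\{0\}$; let $q_{k+1}\colon W_{k+1}\to Y$ be the map induced by $q_k$ and the maps $D^n\times I_0\to Y$ of these squares. Let $W=\operatorname{colim}_{k\ge 0}W_k$, let $j\colon X=W_0\to W$ be the canonical map and let $q\colon W\to Y$ be the colimit of the maps $q_k$. A commutative square from $f$ to $f'$ induces a map $W\to W'$ by sending the cell indexed by a square to the cell indexed by the composite square; in this way $W$ is a functor of $f$, and $j$ and $q$ are natural transformations. A relative cell complex (respectively, a relative $J$-cell complex)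 is an inclusion of a subspace $A\to B$ such that $B$ is constructed from $A$ by a (possibly transfinite) process of attaching cells $D^n$ along $S^{n-1}$ (respectively, attaching $D^n\times I_0$ along $D^n\times\{0\}$), that is, a transfinite composition of pushouts of coproducts of the maps $S^{n-1}\to D^n$ (respectively, of elements of $J$). A cofibration is a retract of a relative cell complex. A weak equivalence is a map $g\colon A\to B$ such that either $A$ and $B$ are both empty, or both are nonempty and $g_*\colon\pi_i(A,a)\to\pi_i(B,g(a))$ is an isomorphism for all $a\in A$ and all $i\ge 0$ (a bijection of sets for $i=0$). A fibration is a Serre fibration, i.e. a map with the homotopy lifting property for all disks $D^n$, $n\ge 0$. **Proposition.** For every continuous map $f\colon X\to Y$, the functorial factorization $X\xrightarrow{\,j\,}W\xrightarrow{\,q\,}Y$ constructed above satisfies $qj=f$; the map $j$ is a relative $J$-cell complex, and $q$ has the right lifting property with respect to every element of $J$. Moreover $j$ is a relative cell complex, hence a cofibration, and it is a weak equivalence, and $q$ is a fibration. -/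

import Mathlib

universe u

open CategoryTheory CategoryTheory.Limits HomotopicalAlgebra
open scoped unitInterval Topology Topology.Homotopy

noncomputable section

namespace QuillenTop

/-! ### Homotopy groups and weak homotopy equivalences -/

section HomotopyGroups

variable {X Y : Type*} [TopologicalSpace X] [TopologicalSpace Y]

/-- Postcomposition of a generalized loop (a map of the cube sending the boundary to the
basepoint) with a continuous map. -/
def genLoopMap (f : C(X, Y)) (n : ℕ) (x : X) (p : Ω^ (Fin n) X x) : Ω^ (Fin n) Y (f x) :=
  ⟨f.comp p.1, fun y hy => congrArg f (p.2 y hy)⟩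

/-- The map `f_* : π_n(X, x) → π_n(Y, f x)` induced by a continuous map `f`. -/
def piMap (f : C(X, Y)) (n : ℕ) (x : X) : π_ n X x → π_ n Y (f x) :=
  Quotient.map (genLoopMap f n x) (fun _ _ h => h.map fun H => H.compContinuousMap f)

/-- In positive degrees the induced map is a homomorphism of groups, so that it is an isomorphism
of groups exactly when it is bijective. -/
theorem piMap_mul (f : C(X, Y)) (n : ℕ) (x : X) (a b : π_ (n + 1) X x) :
    piMap f (n + 1) x (a * b) = piMap f (n + 1) x a * piMap f (n + 1) x b := by
  induction a using Quotient.inductionOn with | _ p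
  induction b using Quotient.inductionOn with | _ q
  have h1 := HomotopyGroup.mul_spec (i := (0 : Fin (n + 1))) (p := p) (q := q)
  have h2 := HomotopyGroup.mul_spec (i := (0 : Fin (n + 1)))
    (p := genLoopMap f (n + 1) x p) (q := genLoopMap f (n + 1) x q)
  refine (congrArg (piMap f (n + 1) x) h1).trans (Eq.trans ?_ h2.symm)
  refine congrArg (Quotient.mk _) (GenLoop.ext _ _ fun t => ?_)
  exact apply_ite f _ _ _

/-- A continuous map is a weak homotopy equivalence if both spaces are empty, or if both are
nonempty and for every choice of basepoint the induced maps of homotopy groups (of sets of path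
components, in degree `0`) are all isomorphisms. -/
def IsWeakHomotopyEquivalence (f : C(X, Y)) : Prop :=
  (IsEmpty X ∧ IsEmpty Y) ∨
    (Nonempty X ∧ Nonempty Y ∧ ∀ (x : X) (n : ℕ), Function.Bijective (piMap f n x))

end HomotopyGroups

/-! ### Serre fibrations -/

/-- A continuous map `p : X → Y` is a Serre fibration if it has the homotopy lifting property for
all closed disks `D^n`, `n ≥ 0`: every homotopy `h : D^n × I → Y` whose restriction to
`D^n × {0}` is lifted by `g` has a lift that starts at `g`. -/
def IsSerreFibration {X Y : Type*} [TopologicalSpace X] [TopologicalSpace Y] (p : C(X, Y)) :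
    Prop :=
  ∀ (n : ℕ) (g : C(Metric.closedBall (0 : EuclideanSpace ℝ (Fin n)) 1, X))
    (h : C(Metric.closedBall (0 : EuclideanSpace ℝ (Fin n)) 1 × I, Y)),
    (∀ d, h (d, 0) = p (g d)) →
      ∃ H : C(Metric.closedBall (0 : EuclideanSpace ℝ (Fin n)) 1 × I, X),
        (∀ d, H (d, 0) = g d) ∧ ∀ z, p (H z) = h z

/-! ### The generating maps and relative cell complexes -/

/-- The space `D^n × {0}`. -/
def cylBase (n : ℕ) : TopCat.{u} := TopCat.of (TopCat.disk.{u} n × ({0} : Set I))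

/-- The space `D^n × I`. -/
def cyl (n : ℕ) : TopCat.{u} := TopCat.of (TopCat.disk.{u} n × I)

/-- The generating trivial cofibrations: the inclusions `D^n × {0} → D^n × I`, `n ≥ 0`. -/
def genJ (n : ℕ) : cylBase.{u} n ⟶ cyl.{u} n :=
  TopCat.ofHom ⟨fun z => (z.1, (z.2 : I)), by fun_prop⟩

/-- The generating cofibrations: the inclusions `S^{n-1} → D^n`, `n ≥ 0`. -/
def genI (n : ℕ) : TopCat.diskBoundary.{u} n ⟶ TopCat.disk.{u} n :=
  TopCat.diskBoundaryInclusion n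

/-- Given a family of maps `g`, the relative `g`-cell complexes are the inclusions of a subspace
`f : X ⟶ Y` such that `Y` can be constructed from `X` by a transfinite process of attaching
cells of the form `g n`: there is a well-ordered set and a continuous diagram of spaces indexed
by it that starts at `X` and has colimit `Y`, in which the passage to each successor is
a pushout of a coproduct of maps in the family. -/
def relativeCells {A B : ℕ → TopCat.{u}} (g : ∀ n, A n ⟶ B n) : MorphismProperty TopCat.{u} :=
  fun _ _ f => Topology.IsEmbedding f.hom ∧
    ∃ (K : Type u) (_ : LinearOrder K) (_ : OrderBot K) (_ : SuccOrder K) (_ : WellFoundedLT K),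
      Nonempty (RelativeCellComplex.{u} (fun _ : K => g) f)

/-- Relative cell complexes: built by attaching disks along their boundary spheres. -/
def relativeCellComplexes : MorphismProperty TopCat.{u} := relativeCells genI

/-- Relative `J`-cell complexes: built by attaching `D^n × I` along `D^n × {0}`. -/
def relativeJCellComplexes : MorphismProperty TopCat.{u} := relativeCells genJ

/-- The cofibrations: the relative cell complexes and their retracts. -/
def cofibrations : MorphismProperty TopCat.{u} := relativeCellComplexes.retracts

/-- The weak equivalences: the weak homotopy equivalences. -/
def weakEquivalences : MorphismProperty TopCat.{u} :=
  fun _ _ f => IsWeakHomotopyEquivalence f.hom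

/-- The fibrations: the Serre fibrations. -/
def fibrations : MorphismProperty TopCat.{u} := fun _ _ f => IsSerreFibration f.hom

/-! ### The functorial `J`-factorization -/

/-- The stages `W_k`, with their maps `q_k : W_k ⟶ Y`, in the factorization of `f : X ⟶ Y`.
We have `W_0 = X` and `q_0 = f`, and `W_{k+1}` is the pushout of
`∐ D^n × I ⟵ ∐ D^n × {0} ⟶ W_k`, with one summand for each `n` and each commutative square from
`D^n × {0} ⟶ D^n × I` to `q_k`. -/
def stage (f : Arrow TopCat.{u}) : ℕ → Over f.right
  | 0 => Over.mk f.hom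
  | k + 1 => Over.mk (SmallObject.πFunctorObj genJ (stage f k).hom)

/-- The inclusion `W_k ⟶ W_{k+1}`. -/
def stageStep (f : Arrow TopCat.{u}) (k : ℕ) : (stage f k).left ⟶ (stage f (k + 1)).left :=
  SmallObject.ιFunctorObj genJ (stage f k).hom

theorem stageStep_hom (f : Arrow TopCat.{u}) (k : ℕ) :
    stageStep f k ≫ (stage f (k + 1)).hom = (stage f k).hom :=
  SmallObject.ιFunctorObj_πFunctorObj genJ (stage f k).hom

/-- The sequence `X = W_0 ⟶ W_1 ⟶ W_2 ⟶ ⋯`. -/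
def stageSeq (f : Arrow TopCat.{u}) : ℕ ⥤ TopCat.{u} :=
  Functor.ofSequence (X := fun k => (stage f k).left) (stageStep f)

theorem stageSeq_map_succ (f : Arrow TopCat.{u}) (k : ℕ) :
    (stageSeq f).map (homOfLE k.le_succ) = stageStep f k :=
  Functor.ofSequence_map_homOfLE_succ _ k

/-- The maps `q_k` as a cocone with vertex `Y`. -/
def stageCocone (f : Arrow TopCat.{u}) : Cocone (stageSeq f) where
  pt := f.right
  ι := NatTrans.ofSequence (fun k => (stage f k).hom) (fun k => by
    rw [stageSeq_map_succ]
    exact (stageStep_hom f k).trans (Category.comp_id _).symm)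

/-- A commutative square `τ` from `f` to `g` induces maps of the stages over `Y ⟶ Y'`. The cell
of `W_{k+1}` indexed by a square is sent to the cell of `W'_{k+1}` indexed by the composite
square. -/
def stageMap {f g : Arrow TopCat.{u}} (τ : f ⟶ g) : (k : ℕ) →
    {m : (stage f k).left ⟶ (stage g k).left // m ≫ (stage g k).hom = (stage f k).hom ≫ τ.right}
  | 0 => ⟨τ.left, τ.w⟩
  | k + 1 =>
    ⟨SmallObject.functorMap genJ (πX := (stage f k).hom) (πY := (stage g k).hom)
        (Arrow.homMk (stageMap τ k).1 τ.right (stageMap τ k).2),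
      SmallObject.functorMap_π genJ _⟩

theorem stageStep_stageMap {f g : Arrow TopCat.{u}} (τ : f ⟶ g) (k : ℕ) :
    stageStep f k ≫ (stageMap τ (k + 1)).1 = (stageMap τ k).1 ≫ stageStep g k :=
  SmallObject.ιFunctorObj_naturality genJ _

theorem stageMap_id (f : Arrow TopCat.{u}) (k : ℕ) : (stageMap (𝟙 f) k).1 = 𝟙 _ := by
  induction k with
  | zero => rfl
  | succ k ih =>
    have h : (Arrow.homMk (stageMap (𝟙 f) k).1 (𝟙 f : f ⟶ f).right (stageMap (𝟙 f) k).2 :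
        Arrow.mk (stage f k).hom ⟶ Arrow.mk (stage f k).hom) = 𝟙 _ := by
      ext1
      · exact ih
      · rfl
    change SmallObject.functorMap genJ _ = _
    rw [h]
    exact SmallObject.functorMap_id genJ _

theorem functorMap_comp {S T U A B C : TopCat.{u}} {a : A ⟶ S} {b : B ⟶ T} {c : C ⟶ U}
    (τ : Arrow.mk a ⟶ Arrow.mk b) (ρ : Arrow.mk b ⟶ Arrow.mk c) :
    SmallObject.functorMap genJ (τ ≫ ρ) =
      SmallObject.functorMap genJ τ ≫ SmallObject.functorMap genJ ρ :=
  congrArg (fun m => Arrow.Hom.left m) ((SmallObject.functor genJ.{u}).map_comp τ ρ)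

theorem stageMap_comp {f g h : Arrow TopCat.{u}} (τ : f ⟶ g) (ρ : g ⟶ h) (k : ℕ) :
    (stageMap (τ ≫ ρ) k).1 = (stageMap τ k).1 ≫ (stageMap ρ k).1 := by
  induction k with
  | zero => rfl
  | succ k ih =>
    have e : (Arrow.homMk (stageMap (τ ≫ ρ) k).1 (τ ≫ ρ).right (stageMap (τ ≫ ρ) k).2 :
        Arrow.mk (stage f k).hom ⟶ Arrow.mk (stage h k).hom) =
        (Arrow.homMk (stageMap τ k).1 τ.right (stageMap τ k).2 :
          Arrow.mk (stage f k).hom ⟶ Arrow.mk (stage g k).hom) ≫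
        (Arrow.homMk (stageMap ρ k).1 ρ.right (stageMap ρ k).2 :
          Arrow.mk (stage g k).hom ⟶ Arrow.mk (stage h k).hom) := by
      ext1
      · exact ih
      · rfl
    change SmallObject.functorMap genJ _ = _
    rw [e]
    exact functorMap_comp _ _

/-- The induced map of sequences. -/
def stageSeqMap {f g : Arrow TopCat.{u}} (τ : f ⟶ g) : stageSeq f ⟶ stageSeq g :=
  NatTrans.ofSequence (fun k => (stageMap τ k).1) (fun k => by
    rw [stageSeq_map_succ, stageSeq_map_succ]
    exact stageStep_stageMap τ k)

/-- The middle space `W = colim_k W_k` of the factorization, as a functor of the map that is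
factored. -/
def factObj : Arrow TopCat.{u} ⥤ TopCat.{u} where
  obj f := colimit (stageSeq f)
  map τ := colimMap (stageSeqMap τ)
  map_id f := by
    refine colimit.hom_ext fun k => ?_
    rw [ι_colimMap]
    exact (congrArg (· ≫ _) (stageMap_id f k)).trans
      ((Category.id_comp _).trans (Category.comp_id _).symm)
  map_comp τ ρ := by
    refine colimit.hom_ext fun k => ?_
    rw [ι_colimMap, ι_colimMap_assoc, ι_colimMap]
    exact (congrArg (· ≫ _) (stageMap_comp τ ρ k)).trans (Category.assoc _ _ _)

/-- The first map `j : X = W_0 ⟶ W` of the factorization, natural in the factored map. -/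
def factLeft : Arrow.leftFunc ⟶ factObj.{u} where
  app f := colimit.ι (stageSeq f) 0
  naturality _ _ τ := (ι_colimMap (stageSeqMap τ) 0).symm

/-- The second map `q : W ⟶ Y` of the factorization, the colimit of the `q_k`, natural in the
factored map. -/
def factRight : factObj.{u} ⟶ Arrow.rightFunc where
  app f := colimit.desc (stageSeq f) (stageCocone f)
  naturality f g τ := by
    refine colimit.hom_ext fun k => ?_
    have h1 : colimit.ι (stageSeq f) k ≫ colimMap (stageSeqMap τ) ≫
        colimit.desc (stageSeq g) (stageCocone g) = (stageMap τ k).1 ≫ (stage g k).hom := by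
      rw [ι_colimMap_assoc, colimit.ι_desc]
      rfl
    have h2 := colimit.ι_desc (stageCocone f) k
    exact h1.trans ((stageMap τ k).2.trans
      ((congrArg (· ≫ τ.right) h2.symm).trans (Category.assoc _ _ _)))

end QuillenTop

end

/-! The inclusions `W_k → W` lift against every map with the right lifting property for `J`, and two
such lifts do most of the work. Lifting the identity of `W_k` against `W_k → *` gives a retraction
`W → W_k` (`exists_retraction`), so the stages are embedded. Lifting constant paths against the path
fibration `W^I → W × W` deforms `W` into `X` with `X` fixed, so `j` is a weak equivalence
(`weakEquivalences_factLeft`).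

For `q`, the small object argument needs every map from the compact space `D^n × {0}` to `W` to land
in some `W_k`; the lifting problem then indexes a cell of `W_{k+1}`. No separation is available, so
compactness is exploited through real functions: the heights in the cells of `W_{m+1}` above `W_m`,
pulled back along the retractions, have a weighted sum that is continuous on `W` but unbounded on an
image contained in no stage (`exists_range_subset_stage`).

Finally, `D^n × {0} → D^n × I` attaches first an `n`-cell, which completes the base to a sphere
`S^n`, and then an `(n+1)`-cell that fills it (`exists_genJ_factorization`). Doing so in all cells
at once splits each step in two, and inserting the intermediate spaces does not change the colimit
(`interleaveIsColimit`). -/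

noncomputable section

/-! ### Relative cell complexes from sequences of cell attachments -/

namespace HomotopicalAlgebra

universe v v' u' t

variable {C : Type u'} [Category.{v'} C]

/-- The order isomorphism between the natural numbers in an arbitrary universe and `ℕ`. -/
def natULiftOrderIso : ULift.{u} ℕ ≃o ℕ where
  toEquiv := Equiv.ulift
  map_rel_iff' := Iff.rfl

/-- The index set in `relativeCells` has to live in `Type u`, hence the lifted copy of `ℕ`. -/
instance : SuccOrder (ULift.{u} ℕ) := SuccOrder.ofOrderIso natULiftOrderIso.symm

/-- The colimit of a sequence is a transfinite composition indexed by the natural numbers in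
an arbitrary universe. -/
def transfiniteCompositionOfSequence {F : ℕ ⥤ C} {c : Cocone F} (hc : IsColimit c) :
    TransfiniteCompositionOfShape (ULift.{u} ℕ) (c.ι.app 0) where
  F := natULiftOrderIso.{u}.equivalence.functor ⋙ F
  isoBot := Iso.refl _
  incl := Functor.whiskerLeft natULiftOrderIso.{u}.equivalence.functor c.ι
  isColimit := IsColimit.whiskerEquivalence hc natULiftOrderIso.{u}.equivalence
  fac := Category.id_comp _

/-- The colimit of a sequence in which every step attaches cells is a relative cell complex. -/
def relativeCellComplexOfSequence {α : Type t} {A B : α → C} (g : ∀ a, A a ⟶ B a)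
    {F : ℕ ⥤ C} {c : Cocone F} (hc : IsColimit c)
    (h : ∀ k : ℕ, AttachCells.{v} g (F.map (homOfLE k.le_succ))) :
    RelativeCellComplex.{v} (fun _ : ULift.{u} ℕ => g) (c.ι.app 0) where
  toTransfiniteCompositionOfShape := transfiniteCompositionOfSequence hc
  attachCells j _ := h j.down

/-! ### Splitting one attachment of cells into two -/

section Coproduct

variable {ι : Type t} {P₁ P₂ P₃ P₄ : ι → C} {a : ∀ i, P₁ i ⟶ P₂ i} {b : ∀ i, P₁ i ⟶ P₃ i}
  {c : ∀ i, P₂ i ⟶ P₄ i} {d : ∀ i, P₃ i ⟶ P₄ i}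

/-- A coproduct of pushout squares is a pushout square. -/
theorem isPushout_sigmaMap [HasCoproduct P₁] [HasCoproduct P₂] [HasCoproduct P₃] [HasCoproduct P₄]
    (h : ∀ i, IsPushout (a i) (b i) (c i) (d i)) :
    IsPushout (Limits.Sigma.map a) (Limits.Sigma.map b) (Limits.Sigma.map c) (Limits.Sigma.map d) := by
  have w : Limits.Sigma.map a ≫ Limits.Sigma.map c = Limits.Sigma.map b ≫ Limits.Sigma.map d := by
    refine Sigma.hom_ext _ _ fun i => ?_
    simp [(h i).w_assoc]
  have e (s : PushoutCocone (Limits.Sigma.map a) (Limits.Sigma.map b)) (i : ι) :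
      a i ≫ Sigma.ι P₂ i ≫ s.inl = b i ≫ Sigma.ι P₃ i ≫ s.inr := by
    simpa using Sigma.ι P₁ i ≫= s.condition
  refine ⟨⟨w⟩, ⟨PushoutCocone.IsColimit.mk _
    (fun s => Sigma.desc fun i => (h i).desc (Sigma.ι P₂ i ≫ s.inl) (Sigma.ι P₃ i ≫ s.inr) (e s i))
    (fun s => ?_) (fun s => ?_) (fun s m hl hr => ?_)⟩⟩
  · refine Sigma.hom_ext _ _ fun i => ?_
    simp
  · refine Sigma.hom_ext _ _ fun i => ?_
    simp
  · refine Sigma.hom_ext _ _ fun i => (h i).hom_ext ?_ ?_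
    · simp [← hl]
    · simp [← hr]

end Coproduct

/-- If each generating cell `p a ≫ e a` factors through a pushout `p a` of a map `b a`, then
attaching cells of the form `p a ≫ e a` amounts to attaching first cells of the form `b a`, and
then cells of the form `e a`. -/
theorem AttachCells.exists_factorization {α : Type t} {S D A P B : α → C}
    {s : ∀ a, S a ⟶ A a} {b : ∀ a, S a ⟶ D a} {p : ∀ a, A a ⟶ P a} {d : ∀ a, D a ⟶ P a}
    (sq : ∀ a, IsPushout (s a) (b a) (p a) (d a)) (e : ∀ a, P a ⟶ B a)
    [HasCoproducts.{v} C] [HasPushouts C]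
    {X Y : C} {f : X ⟶ Y} (c : AttachCells.{v} (fun a => p a ≫ e a) f) :
    ∃ (Z : C) (f₁ : X ⟶ Z) (f₂ : Z ⟶ Y), f₁ ≫ f₂ = f ∧
      Nonempty (AttachCells.{v} b f₁) ∧ Nonempty (AttachCells.{v} e f₂) := by
  -- The cofans of `c` are arbitrary colimits; these isomorphisms carry its pushout square to the
  -- chosen coproducts, where the map of cells visibly factors.
  let eA : (∐ fun i => A (c.π i)) ≅ c.cofan₁.pt :=
    (coproductIsCoproduct _).coconePointUniqueUpToIso c.isColimit₁
  let eB : (∐ fun i => B (c.π i)) ≅ c.cofan₂.pt :=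
    (coproductIsCoproduct _).coconePointUniqueUpToIso c.isColimit₂
  have heA (i : c.ι) : Sigma.ι (fun i => A (c.π i)) i ≫ eA.hom = c.cofan₁.inj i :=
    IsColimit.comp_coconePointUniqueUpToIso_hom (coproductIsCoproduct _) c.isColimit₁ ⟨i⟩
  have heB (i : c.ι) : Sigma.ι (fun i => B (c.π i)) i ≫ eB.hom = c.cofan₂.inj i :=
    IsColimit.comp_coconePointUniqueUpToIso_hom (coproductIsCoproduct _) c.isColimit₂ ⟨i⟩
  have hX : IsPushout (eA.hom ≫ c.g₁) (Limits.Sigma.map (fun i => p (c.π i)) ≫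
      Limits.Sigma.map (fun i => e (c.π i))) f (eB.hom ≫ c.g₂) := by
    refine c.isPushout.of_iso eA.symm (Iso.refl _) eB.symm (Iso.refl _) ?_ ?_ ?_ ?_
    · simp
    · rw [← cancel_mono eB.hom, ← cancel_epi eA.hom]
      simp only [Iso.symm_hom, Category.assoc, Iso.inv_hom_id, Category.comp_id,
        Iso.hom_inv_id_assoc]
      refine Sigma.hom_ext _ _ fun i => ?_
      rw [← Category.assoc, heA, c.hm]
      simp [heB]
    · simp
    · simp
  let f₁ : X ⟶ pushout (eA.hom ≫ c.g₁) (Limits.Sigma.map fun i => p (c.π i)) := pushout.inl _ _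
  have h₁ := IsPushout.of_hasPushout (eA.hom ≫ c.g₁) (Limits.Sigma.map fun i => p (c.π i))
  let f₂ : pushout (eA.hom ≫ c.g₁) (Limits.Sigma.map fun i => p (c.π i)) ⟶ Y :=
    pushout.desc f (Limits.Sigma.map (fun i => e (c.π i)) ≫ eB.hom ≫ c.g₂) (by simpa using hX.w)
  have hf : f₁ ≫ f₂ = f := pushout.inl_desc _ _ _
  -- Cancellation of pushouts: the outer square is `hX` and the first part is `h₁`.
  have h₂ : IsPushout (pushout.inr _ _) (Limits.Sigma.map fun i => e (c.π i)) f₂ (eB.hom ≫ c.g₂) :=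
    IsPushout.of_top (hf.symm ▸ hX) (pushout.inr_desc _ _ _) h₁
  refine ⟨_, f₁, f₂, hf, ⟨?_⟩, ⟨?_⟩⟩
  · exact
      { ι := c.ι
        π := c.π
        cofan₁ := _
        cofan₂ := _
        isColimit₁ := coproductIsCoproduct _
        isColimit₂ := coproductIsCoproduct _
        m := Limits.Sigma.map fun i => b (c.π i)
        hm := fun i => Sigma.ι_map _ _
        g₁ := _
        g₂ := _
        isPushout := (isPushout_sigmaMap fun i => sq (c.π i)).paste_horiz h₁ }
  · exact
      { ι := c.ι
        π := c.π
        cofan₁ := _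
        cofan₂ := _
        isColimit₁ := coproductIsCoproduct _
        isColimit₂ := coproductIsCoproduct _
        m := Limits.Sigma.map fun i => e (c.π i)
        hm := fun i => Sigma.ι_map _ _
        g₁ := _
        g₂ := _
        isPushout := h₂ }

/-! ### Refining a sequence by factoring its steps -/

section Interleave

variable {F : ℕ ⥤ C} {Z : ℕ → C} (f₁ : ∀ k, F.obj k ⟶ Z k) (f₂ : ∀ k, Z k ⟶ F.obj (k + 1))

/-- The successor in the lexicographic order on `ℕ × Bool`. -/
def interleaveNext : ℕ × Bool → ℕ × Bool
  | (k, false) => (k, true)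
  | (k, true) => (k + 1, false)

/-- The enumeration of `ℕ × Bool` in lexicographic order. -/
def interleaveIndex : ℕ → ℕ × Bool
  | 0 => (0, false)
  | n + 1 => interleaveNext (interleaveIndex n)

/-- The position of an element of `ℕ × Bool` in the lexicographic order. -/
def interleavePos : ℕ × Bool → ℕ
  | (k, false) => 2 * k
  | (k, true) => 2 * k + 1

theorem interleavePos_next (s : ℕ × Bool) :
    interleavePos (interleaveNext s) = interleavePos s + 1 := by
  rcases s with ⟨k, _ | _⟩ <;> rfl

theorem interleaveIndex_two_mul (k : ℕ) : interleaveIndex (2 * k) = (k, false) := by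
  induction k with
  | zero => rfl
  | succ k ih =>
    change interleaveNext (interleaveNext (interleaveIndex (2 * k))) = _
    rw [ih]; rfl

theorem interleaveIndex_pos (s : ℕ × Bool) : interleaveIndex (interleavePos s) = s := by
  rcases s with ⟨k, _ | _⟩
  · exact interleaveIndex_two_mul k
  · change interleaveNext (interleaveIndex (2 * k)) = _
    rw [interleaveIndex_two_mul]; rfl

variable (F Z) in
/-- The terms of the refined sequence. -/
def interleaveObj : ℕ × Bool → C
  | (k, false) => F.obj k
  | (k, true) => Z k

/-- The steps of the refined sequence. -/
def interleaveStep : ∀ s : ℕ × Bool, interleaveObj F Z s ⟶ interleaveObj F Z (interleaveNext s)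
  | (k, false) => f₁ k
  | (k, true) => f₂ k

/-- The refinement `F 0 ⟶ Z 0 ⟶ F 1 ⟶ Z 1 ⟶ ⋯` of a sequence `F`. -/
def interleave : ℕ ⥤ C :=
  Functor.ofSequence (X := fun n => interleaveObj F Z (interleaveIndex n))
    (fun n => interleaveStep f₁ f₂ (interleaveIndex n))

theorem interleave_map_succ (n : ℕ) : (interleave f₁ f₂).map (homOfLE n.le_succ) =
    interleaveStep f₁ f₂ (interleaveIndex n) :=
  Functor.ofSequence_map_homOfLE_succ _ n

/-- The maps from the terms of the refined sequence to the vertex of a cocone. -/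
def interleaveIncl (c : Cocone F) : ∀ s : ℕ × Bool, interleaveObj F Z s ⟶ c.pt
  | (k, false) => c.ι.app k
  | (k, true) => f₂ k ≫ c.ι.app (k + 1)

variable (hf : ∀ k : ℕ, f₁ k ≫ f₂ k = F.map (homOfLE k.le_succ))

include hf in
theorem interleaveStep_incl (c : Cocone F) (s : ℕ × Bool) :
    interleaveStep f₁ f₂ s ≫ interleaveIncl f₂ c (interleaveNext s) = interleaveIncl f₂ c s := by
  rcases s with ⟨k, _ | _⟩
  · exact (Category.assoc _ _ _).symm.trans ((congrArg (· ≫ _) (hf k)).trans (c.w _))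
  · rfl

/-- A cocone of a sequence extends to its refinement. -/
def interleaveCocone (c : Cocone F) : Cocone (interleave f₁ f₂) where
  pt := c.pt
  ι := NatTrans.ofSequence (fun n => interleaveIncl f₂ c (interleaveIndex n)) (fun n => by
    rw [interleave_map_succ]
    exact (interleaveStep_incl f₁ f₂ hf c _).trans (Category.comp_id _).symm)

/-- The map from a term of the refined sequence to the vertex of a cocone. -/
def interleaveLeg (t : Cocone (interleave f₁ f₂)) (s : ℕ × Bool) : interleaveObj F Z s ⟶ t.pt :=
  eqToHom (congrArg (interleaveObj F Z) (interleaveIndex_pos s).symm) ≫ t.ι.app (interleavePos s)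

/-- Positions and indices are inverse only up to propositional equality. With `n` a free variable,
`subst` absorbs the transport. -/
theorem eqToHom_comp_leg (t : Cocone (interleave f₁ f₂)) (s : ℕ × Bool) (n : ℕ)
    (h : s = interleaveIndex n) (h' : n = interleavePos s) :
    eqToHom (congrArg (interleaveObj F Z) h) ≫ t.ι.app n = interleaveLeg f₁ f₂ t s := by
  subst h'
  rfl

theorem interleaveStep_comp_eqToHom {s s' : ℕ × Bool} (h : s = s') :
    interleaveStep f₁ f₂ s ≫ eqToHom (congrArg (fun x => interleaveObj F Z (interleaveNext x)) h) =
      eqToHom (congrArg (interleaveObj F Z) h) ≫ interleaveStep f₁ f₂ s' := by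
  subst h
  simp

/-- Applied at `(k, false)` and `(k, true)`, this makes the even legs of `t` a cocone on `F`; at
`(k, true)` it also recovers the odd legs. -/
theorem interleaveStep_leg (t : Cocone (interleave f₁ f₂)) (s : ℕ × Bool) :
    interleaveStep f₁ f₂ s ≫ interleaveLeg f₁ f₂ t (interleaveNext s) =
      interleaveLeg f₁ f₂ t s := by
  rw [← eqToHom_comp_leg f₁ f₂ t (interleaveNext s) (interleavePos s + 1)
    (congrArg interleaveNext (interleaveIndex_pos s).symm) (interleavePos_next s).symm,
    interleaveLeg, ← t.w (homOfLE (interleavePos s).le_succ), interleave_map_succ]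
  refine (Category.assoc _ _ _).symm.trans (Eq.trans ?_ (Category.assoc _ _ _))
  exact congrArg (· ≫ _) (interleaveStep_comp_eqToHom f₁ f₂ (interleaveIndex_pos s).symm)

/-- The cocone of a sequence obtained from a cocone of its refinement. -/
def uninterleaveCocone (t : Cocone (interleave f₁ f₂)) : Cocone F where
  pt := t.pt
  ι := NatTrans.ofSequence (fun k => interleaveLeg f₁ f₂ t (k, false)) (fun k => by
    have h1 := interleaveStep_leg f₁ f₂ t (k, false)
    have h2 := interleaveStep_leg f₁ f₂ t (k, true)
    rw [← hf]
    refine (Category.assoc _ _ _).trans (Eq.trans ?_ (Category.comp_id _).symm)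
    exact (congrArg (f₁ k ≫ ·) h2).trans h1)

theorem app_eq_leg (t : Cocone (interleave f₁ f₂)) (n : ℕ) :
    ∀ s (h : interleaveIndex n = s), t.ι.app n =
      eqToHom (congrArg (interleaveObj F Z) h) ≫ interleaveLeg f₁ f₂ t s := by
  intro s h
  have hn : n = interleavePos s := by
    subst h
    induction n with
    | zero => rfl
    | succ n ih => exact (congrArg (· + 1) ih).trans (interleavePos_next _).symm
  rw [← eqToHom_comp_leg f₁ f₂ t s n h.symm hn]
  subst h
  exact ((Category.id_comp _).trans (Category.id_comp _)).symm

/-- A sequence and its refinement have the same colimit. -/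
def interleaveIsColimit {c : Cocone F} (hc : IsColimit c) :
    IsColimit (interleaveCocone f₁ f₂ hf c) where
  desc t := hc.desc (uninterleaveCocone f₁ f₂ hf t)
  fac t n := by
    have key (s : ℕ × Bool) : interleaveIncl f₂ c s ≫ hc.desc (uninterleaveCocone f₁ f₂ hf t) =
        interleaveLeg f₁ f₂ t s := by
      rcases s with ⟨k, _ | _⟩
      · exact hc.fac _ k
      · refine (Category.assoc _ _ _).trans ?_
        refine (congrArg (f₂ k ≫ ·) (hc.fac _ (k + 1))).trans ?_
        exact interleaveStep_leg f₁ f₂ t (k, true)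
    refine (key (interleaveIndex n)).trans ?_
    have := app_eq_leg f₁ f₂ t n _ rfl
    rw [eqToHom_refl] at this
    exact (this.trans (Category.id_comp _)).symm
  uniq t m hm := by
    -- The even terms are those of `F`, and they already determine `m`.
    refine hc.hom_ext fun k => ?_
    refine Eq.trans ?_ (hc.fac (uninterleaveCocone f₁ f₂ hf t) k).symm
    have key : ∀ (n : ℕ) (s) (h : interleaveIndex n = s), interleaveIncl f₂ c s ≫ m =
        eqToHom (congrArg (interleaveObj F Z) h.symm) ≫ t.ι.app n := by
      rintro n _ rfl
      exact (hm n).trans (Category.id_comp _).symm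
    refine (key (2 * k) (k, false) (interleaveIndex_two_mul k)).trans ?_
    exact eqToHom_comp_leg f₁ f₂ t (k, false) _ (interleaveIndex_two_mul k).symm rfl

/-- The steps of the refined sequence attach cells. -/
def interleaveStepAttachCells {α : Type t} {A B : α → C} (g : ∀ a, A a ⟶ B a)
    (h₁ : ∀ k, AttachCells.{v} g (f₁ k)) (h₂ : ∀ k, AttachCells.{v} g (f₂ k)) :
    ∀ s, AttachCells.{v} g (interleaveStep f₁ f₂ s)
  | (k, false) => h₁ k
  | (k, true) => h₂ k

/-- If every step of a sequence is a composition of two maps that attach cells, then the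
colimit of the sequence is a relative cell complex. -/
def relativeCellComplexOfFactoredSequence {α : Type t} {A B : α → C} (g : ∀ a, A a ⟶ B a)
    {c : Cocone F} (hc : IsColimit c)
    (h₁ : ∀ k, AttachCells.{v} g (f₁ k)) (h₂ : ∀ k, AttachCells.{v} g (f₂ k)) :
    RelativeCellComplex.{v} (fun _ : ULift.{u} ℕ => g) (c.ι.app 0) :=
  relativeCellComplexOfSequence g (c := interleaveCocone f₁ f₂ hf c)
    (interleaveIsColimit f₁ f₂ hf hc) fun n => by
      rw [interleave_map_succ]
      exact interleaveStepAttachCells f₁ f₂ g h₁ h₂ (interleaveIndex n)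

end Interleave

end HomotopicalAlgebra

namespace QuillenTop

/-! ### The stages of the factorization -/

/-- The passage from `W_k` to `W_{k+1}` attaches cells of the form `D^n × I`. -/
def stageStepAttachCells (f : Arrow TopCat.{u}) (k : ℕ) : AttachCells.{u} genJ (stageStep f k) :=
  SmallObject.attachCellsιFunctorObj genJ (stage f k).hom

/-- The map `W_k ⟶ W`. -/
def stageIncl (f : Arrow TopCat.{u}) (k : ℕ) : (stage f k).left ⟶ factObj.obj f :=
  colimit.ι (stageSeq f) k

theorem stageStep_stageIncl (f : Arrow TopCat.{u}) (k : ℕ) :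
    stageStep f k ≫ stageIncl f (k + 1) = stageIncl f k := by
  have h := colimit.w (stageSeq f) (homOfLE k.le_succ)
  rw [stageSeq_map_succ] at h
  exact h

theorem stageIncl_factRight (f : Arrow TopCat.{u}) (k : ℕ) :
    stageIncl f k ≫ factRight.app f = (stage f k).hom :=
  colimit.ι_desc (stageCocone f) k

/-- The map `j : X ⟶ W` is a transfinite composition of cell attachments. -/
def factLeftCellComplex (f : Arrow TopCat.{u}) :
    RelativeCellComplex.{u} (fun _ : ULift.{u} ℕ => genJ) (factLeft.app f) :=
  relativeCellComplexOfSequence genJ (colimit.isColimit (stageSeq f)) fun k => by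
    rw [stageSeq_map_succ]
    exact stageStepAttachCells f k

/-- The inclusions of the stages lift against all maps against which the elements of `J` lift. -/
theorem hasLiftingProperty_stageIncl (f : Arrow TopCat.{u}) (k : ℕ) {S T : TopCat.{u}} (p : S ⟶ T)
    (hp : ∀ n, HasLiftingProperty (genJ n) p) : HasLiftingProperty (stageIncl f k) p := by
  have hp' : (MorphismProperty.ofHoms genJ.{u}).rlp p := by
    rintro _ _ _ ⟨n⟩
    exact hp n
  let c := (factLeftCellComplex f).transfiniteCompositionOfShape
  -- A left lifting class is closed under coproducts, pushouts and transfinite compositions, so it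
  -- contains the tail from stage `k` as well as the full composition.
  have h : (MorphismProperty.ofHoms genJ.{u}).rlp.llp (c.incl.app ⟨k⟩) := by
    refine (c.ofLE (W' := (MorphismProperty.ofHoms genJ.{u}).rlp.llp) ?_).mem_incl_app _
    simpa using MorphismProperty.coproducts_le_llp_rlp.{u} (MorphismProperty.ofHoms genJ.{u})
  exact h p hp'

/-! ### Maps with the right lifting property with respect to `J` -/

/-- The projection `D^n × I ⟶ D^n × {0}`. -/
def cylProj (n : ℕ) : cyl.{u} n ⟶ cylBase.{u} n :=
  TopCat.ofHom ⟨fun z => (z.1, ⟨0, rfl⟩), by fun_prop⟩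

theorem genJ_cylProj (n : ℕ) : genJ.{u} n ≫ cylProj n = 𝟙 _ := by
  ext z
  exact Prod.ext rfl (Subtype.ext z.2.2.symm)

/-- The cylinder retracts to its base, so every map on the base extends. -/
theorem hasLiftingProperty_genJ_of_isTerminal (n : ℕ) {S T : TopCat.{u}} (hT : IsTerminal T)
    (p : S ⟶ T) : HasLiftingProperty (genJ.{u} n) p where
  sq_hasLift {t b} sq := ⟨⟨
    { l := cylProj n ≫ t
      fac_left := by rw [← Category.assoc, genJ_cylProj, Category.id_comp]
      fac_right := hT.hom_ext _ _ }⟩⟩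

/-- The stages are retracts of the colimit. -/
theorem exists_retraction (f : Arrow TopCat.{u}) (k : ℕ) :
    ∃ r : factObj.obj f ⟶ (stage f k).left, stageIncl f k ≫ r = 𝟙 _ := by
  have := hasLiftingProperty_stageIncl f k (terminal.from (stage f k).left)
    fun n => hasLiftingProperty_genJ_of_isTerminal n terminalIsTerminal _
  have sq : CommSq (𝟙 _) (stageIncl f k) (terminal.from (stage f k).left) (terminal.from _) :=
    ⟨Subsingleton.elim _ _⟩
  exact ⟨sq.lift, sq.fac_left⟩

theorem isEmbedding_stageIncl (f : Arrow TopCat.{u}) (k : ℕ) :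
    Topology.IsEmbedding (stageIncl f k).hom := by
  obtain ⟨r, hr⟩ := exists_retraction f k
  exact Topology.IsEmbedding.of_leftInverse (f := r.hom)
    (fun x => ConcreteCategory.congr_hom hr x) r.hom.continuous (stageIncl f k).hom.continuous

theorem relativeJCellComplexes_factLeft (f : Arrow TopCat.{u}) :
    relativeJCellComplexes (factLeft.app f) :=
  ⟨isEmbedding_stageIncl f 0, _, _, _, _, _, ⟨factLeftCellComplex f⟩⟩

/-! ### The path fibration -/

section PathFibration

variable {D T : Type*}

/-- Given homotopies `b₀`, `b₁` that start at the ends of a family of paths `t`, the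
family of paths at time `s` obtained by adding the tracks of the homotopies to the paths. -/
def extendPath (t : D × I → T) (b₀ b₁ : D × I → T) (x : (D × I) × I) : T :=
  -- At time `s = x.1.2`: run `b₀` back from `s` to `0` on `[0, s/3]`, then `t` rescaled to length
  -- `1 - 2s/3 ≥ 1/3`, then `b₁` from `0` to `s`.
  if (x.2 : ℝ) ≤ x.1.2 / 3 then b₀ (x.1.1, Set.projIcc 0 1 zero_le_one (x.1.2 - 3 * x.2 : ℝ))
  else if (x.2 : ℝ) ≤ 1 - x.1.2 / 3 then
    t (x.1.1, Set.projIcc 0 1 zero_le_one ((x.2 - x.1.2 / 3) / (1 - 2 * x.1.2 / 3) : ℝ))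
  else b₁ (x.1.1, Set.projIcc 0 1 zero_le_one (x.1.2 - 3 * (1 - x.2) : ℝ))

theorem continuous_extendPath [TopologicalSpace D] [TopologicalSpace T] {t b₀ b₁ : D × I → T}
    (ht : Continuous t) (hb₀ : Continuous b₀)
    (hb₁ : Continuous b₁) (h₀ : ∀ d, b₀ (d, 0) = t (d, 0)) (h₁ : ∀ d, b₁ (d, 0) = t (d, 1)) :
    Continuous (extendPath t b₀ b₁) := by
  have hs (x : (D × I) × I) : (1 - 2 * x.1.2 / 3 : ℝ) ≠ 0 := by
    have := x.1.2.2.2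
    intro h
    linarith
  refine Continuous.if_le ?_ (Continuous.if_le ?_ ?_ ?_ ?_ ?_) ?_ ?_ ?_
  · exact hb₀.comp (Continuous.prodMk (by fun_prop) (continuous_projIcc.comp (by fun_prop)))
  · exact ht.comp (Continuous.prodMk (by fun_prop) (continuous_projIcc.comp
      (Continuous.div (by fun_prop) (by fun_prop) hs)))
  · exact hb₁.comp (Continuous.prodMk (by fun_prop) (continuous_projIcc.comp (by fun_prop)))
  · fun_prop
  · fun_prop
  · intro x hx
    have e1 : ((x.2 - x.1.2 / 3) / (1 - 2 * x.1.2 / 3) : ℝ) = 1 := by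
      rw [div_eq_one_iff_eq (hs x)]
      linarith
    have e2 : (x.1.2 - 3 * (1 - x.2) : ℝ) = 0 := by linarith
    rw [e1, e2, Set.projIcc_left, Set.projIcc_right]
    exact (h₁ _).symm
  · fun_prop
  · fun_prop
  · intro x hx
    have h3 : (x.2 : ℝ) ≤ 1 - x.1.2 / 3 := by
      have := x.1.2.2.2
      linarith
    have e1 : ((x.2 - x.1.2 / 3) / (1 - 2 * x.1.2 / 3) : ℝ) = 0 := by
      rw [hx, sub_self, zero_div]
    have e2 : (x.1.2 - 3 * x.2 : ℝ) = 0 := by linarith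
    rw [if_pos h3, e1, e2, Set.projIcc_left]
    exact h₀ _

/-- At time `0` the outer pieces shrink to points; only `u = 0` still falls under the first branch,
where `h₀` applies. -/
theorem extendPath_time_zero {t b₀ b₁ : D × I → T} (h₀ : ∀ d, b₀ (d, 0) = t (d, 0)) (d : D)
    (u : I) : extendPath t b₀ b₁ ((d, 0), u) = t (d, u) := by
  have hu := u.2.2
  have hu0 := u.2.1
  unfold extendPath
  split_ifs with h1 h2
  · have : u = 0 := Subtype.ext (le_antisymm (by simpa using h1) hu0)
    subst this
    simpa using h₀ d
  · simp
  · exact absurd (by simpa using hu) h2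

theorem extendPath_left (t b₀ b₁ : D × I → T) (z : D × I) :
    extendPath t b₀ b₁ (z, 0) = b₀ z := by
  have h : ((0 : I) : ℝ) ≤ z.2 / 3 := by
    have := z.2.2.1
    simp only [Set.Icc.coe_zero]
    linarith
  rw [extendPath, if_pos h]
  simp

theorem extendPath_right {t b₀ b₁ : D × I → T} (h₁ : ∀ d, b₁ (d, 0) = t (d, 1)) (z : D × I) :
    extendPath t b₀ b₁ (z, 1) = b₁ z := by
  obtain ⟨d, s⟩ := z
  have hs0 := s.2.1
  have hs := s.2.2
  have h : ¬ ((1 : I) : ℝ) ≤ s / 3 := by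
    simp only [Set.Icc.coe_one]
    intro h
    linarith
  rw [extendPath, if_neg h]
  split_ifs with h2
  -- The right end lies in the middle branch only at time `0`, where `h₁` matches the values.
  · have : s = 0 := Subtype.ext (le_antisymm (show (s : ℝ) ≤ 0 by simp at h2; linarith) hs0)
    subst this
    simpa using (h₁ d).symm
  · simp

end PathFibration

/-- The map from the space of paths in `T` to `T × T` that takes the ends of a path. -/
def pathEnds (T : TopCat.{u}) : TopCat.of C(I, T) ⟶ TopCat.of (T × T) :=
  TopCat.ofHom ⟨fun p => (p 0, p 1), by fun_prop⟩

/-- After currying, a lift extends a map from three sides of `I × I` to the whole square, with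
parameters in `D^n`; `extendPath` is such an extension. -/
theorem hasLiftingProperty_genJ_pathEnds (n : ℕ) (T : TopCat.{u}) :
    HasLiftingProperty (genJ.{u} n) (pathEnds T) where
  sq_hasLift {t b} sq := by
    let t' : TopCat.disk.{u} n × I → T := fun z => (t.hom (z.1, ⟨0, rfl⟩) : C(I, T)) z.2
    have ht' : Continuous t' := by
      have : Continuous fun z : TopCat.disk.{u} n × I => (t.hom (z.1, ⟨0, rfl⟩) : C(I, T)) :=
        t.hom.continuous.comp (by fun_prop)
      exact ContinuousEval.continuous_eval.comp (this.prodMk continuous_snd)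
    let b₀ : TopCat.disk.{u} n × I → T := fun z => (b.hom z : T × T).1
    let b₁ : TopCat.disk.{u} n × I → T := fun z => (b.hom z : T × T).2
    have hb₀ : Continuous b₀ := continuous_fst.comp b.hom.continuous
    have hb₁ : Continuous b₁ := continuous_snd.comp b.hom.continuous
    have h (d : TopCat.disk.{u} n) : (t' (d, 0), t' (d, 1)) = (b.hom (d, 0) : T × T) :=
      ConcreteCategory.congr_hom sq.w (d, ⟨0, rfl⟩)
    have h₀ (d) : b₀ (d, 0) = t' (d, 0) := (congrArg Prod.fst (h d)).symm
    have h₁ (d) : b₁ (d, 0) = t' (d, 1) := (congrArg Prod.snd (h d)).symm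
    let l : C(TopCat.disk.{u} n × I, C(I, T)) :=
      ContinuousMap.curry ⟨extendPath t' b₀ b₁, continuous_extendPath ht' hb₀ hb₁ h₀ h₁⟩
    refine ⟨⟨{ l := TopCat.ofHom l, fac_left := ?_, fac_right := ?_ }⟩⟩
    · refine TopCat.hom_ext (ContinuousMap.ext fun z => ?_)
      refine ContinuousMap.ext fun v : I => ?_
      obtain ⟨d, e, he⟩ := z
      obtain rfl : e = 0 := he
      exact extendPath_time_zero h₀ d v
    · refine TopCat.hom_ext (ContinuousMap.ext fun z => ?_)
      exact Prod.ext (extendPath_left t' b₀ b₁ z) (extendPath_right (t := t') (b₀ := b₀) h₁ z)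

/-! ### Strong deformation retractions are weak homotopy equivalences -/

/-- Composition with `r` gives injectivity. For surjectivity, `H` moves a loop `q` to `j ∘ r ∘ q`;
since `H` is constant on the image of `j`, the boundary of the cube stays at the basepoint. -/
theorem isWeakHomotopyEquivalence_of_deformationRetraction {X Y : Type*} [TopologicalSpace X]
    [TopologicalSpace Y] (j : C(X, Y)) (r : C(Y, X)) (hr : r.comp j = ContinuousMap.id X)
    (H : C(Y, C(I, Y))) (h₀ : ∀ y, H y 0 = y) (h₁ : ∀ y, H y 1 = j (r y))
    (hj : ∀ x s, H (j x) s = j x) : IsWeakHomotopyEquivalence j := by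
  have hr' (x : X) : r (j x) = x := DFunLike.congr_fun hr x
  rcases isEmpty_or_nonempty X with hX | hX
  · exact Or.inl ⟨hX, ⟨fun y => hX.false (r y)⟩⟩
  refine Or.inr ⟨hX, hX.map j, fun x n => ⟨?_, ?_⟩⟩
  · intro a b
    induction a using Quotient.inductionOn with | _ p
    induction b using Quotient.inductionOn with | _ q
    intro h
    have h' : GenLoop.Homotopic (genLoopMap j n x p) (genLoopMap j n x q) := Quotient.exact h
    refine Quotient.sound ?_
    obtain ⟨G⟩ := h'
    have key (p : Ω^ (Fin n) X x) : r.comp (genLoopMap j n x p).1 = p.1 :=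
      ContinuousMap.ext fun z => hr' _
    have G' := G.compContinuousMap r
    rw [key, key] at G'
    exact ⟨G'⟩
  · intro b
    induction b using Quotient.inductionOn with | _ q
    let p : Ω^ (Fin n) X x := ⟨r.comp q.1, fun z hz => (congrArg r (q.2 z hz)).trans (hr' x)⟩
    refine ⟨Quotient.mk _ p, Quotient.sound ?_⟩
    refine ContinuousMap.HomotopicRel.symm ⟨?_⟩
    refine ⟨⟨⟨fun z => H (q.1 z.2) z.1, ?_⟩, fun z => h₀ _, fun z => h₁ _⟩, fun s z hz => ?_⟩
    · exact ContinuousEval.continuous_eval.comp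
        ((H.continuous.comp (q.1.continuous.comp continuous_snd)).prodMk continuous_fst)
    · have : q.1 z = j x := q.2 z hz
      change H (q.1 z) s = q.1 z
      rw [this, hj]

/-- Constant paths on `X` and the pairs `(w, j (r w))` form a square over the path fibration; its
lift is the deformation. -/
theorem weakEquivalences_factLeft (f : Arrow TopCat.{u}) :
    weakEquivalences (factLeft.app f) := by
  obtain ⟨r, hr⟩ := exists_retraction f 0
  let W : TopCat.{u} := factObj.obj f
  let j : f.left ⟶ W := factLeft.app f
  let c : (stage f 0).left ⟶ TopCat.of C(I, W) :=
    TopCat.ofHom (ContinuousMap.curry (j.hom.comp ⟨Prod.fst, continuous_fst⟩))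
  let e : W ⟶ TopCat.of (W × W) := TopCat.ofHom ⟨fun w => (w, j.hom (r.hom w)),
    continuous_id.prodMk (j.hom.continuous.comp r.hom.continuous)⟩
  have := hasLiftingProperty_stageIncl f 0 (pathEnds W)
    fun n => hasLiftingProperty_genJ_pathEnds n W
  have hr' (x : f.left) : r.hom (j.hom x) = x := ConcreteCategory.congr_hom hr x
  have sq : CommSq c (stageIncl f 0) (pathEnds W) e := ⟨TopCat.hom_ext
    (ContinuousMap.ext fun x => Prod.ext rfl (congrArg j.hom (hr' x).symm))⟩
  have hl (y : W) : (((sq.lift.hom y : C(I, W)) 0, (sq.lift.hom y : C(I, W)) 1) : W × W) =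
      (y, j.hom (r.hom y)) := ConcreteCategory.congr_hom sq.fac_right y
  refine isWeakHomotopyEquivalence_of_deformationRetraction j.hom r.hom
    (ContinuousMap.ext hr') sq.lift.hom (fun y => congrArg Prod.fst (hl y))
    (fun y => congrArg Prod.snd (hl y)) fun x s => ?_
  exact DFunLike.congr_fun (F := C(I, W)) (ConcreteCategory.congr_hom sq.fac_left x) s

/-! ### Maps from compact spaces to the colimit of the stages -/

/-- To check a property of all points of a space it suffices that every two maps to an indiscrete
space that agree where the property is known are equal. -/
theorem forall_of_hom_ext {B : TopCat.{u}} (P : B → Prop)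
    (h : ∀ φ φ' : B ⟶ TopCat.trivial.obj (ULift.{u} Prop), (∀ b, P b → φ b = φ' b) → φ = φ')
    (b : B) : P b := by
  -- Compare the truth value of `P` with the constant `True`; both are continuous because the target
  -- is indiscrete.
  let φ : B ⟶ TopCat.trivial.obj (ULift.{u} Prop) :=
    TopCat.ofHom (Y := TopCat.trivial.obj (ULift.{u} Prop)) ⟨fun b => ⟨P b⟩, continuous_top⟩
  let φ' : B ⟶ TopCat.trivial.obj (ULift.{u} Prop) :=
    TopCat.ofHom (Y := TopCat.trivial.obj (ULift.{u} Prop)) ⟨fun _ => ⟨True⟩, continuous_top⟩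
  have e : φ = φ' := h φ φ' fun b hb => congrArg ULift.up (eq_true hb)
  exact of_eq_true (congrArg ULift.down (ConcreteCategory.congr_hom e b))

/-- The height above the base of the cells `D^n × I`. -/
theorem exists_height {A B : TopCat.{u}} {i : A ⟶ B} (c : AttachCells.{u} genJ i) :
    ∃ φ : C(B, ℝ), (∀ a, φ (i a) = 0) ∧ ∀ b, φ b = 0 → b ∈ Set.range i := by
  let η (n : ℕ) : cyl.{u} n ⟶ TopCat.of (ULift.{u} ℝ) :=
    TopCat.ofHom ⟨fun z => ⟨(z.2 : ℝ)⟩, by fun_prop⟩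
  let O {T : TopCat.{u}} : T ⟶ TopCat.of (ULift.{u} ℝ) := TopCat.ofHom ⟨fun _ => ⟨0⟩, by fun_prop⟩
  -- Cells are attached at height `0`, so their heights glue with the zero function on `A`.
  let θ : c.cofan₂.pt ⟶ TopCat.of (ULift.{u} ℝ) :=
    Cofan.IsColimit.desc c.isColimit₂ fun k => η (c.π k)
  have hθ (k) : c.cofan₂.inj k ≫ θ = η (c.π k) := Cofan.IsColimit.fac _ _ _
  have w : c.g₁ ≫ O = c.m ≫ θ := by
    refine Cofan.IsColimit.hom_ext c.isColimit₁ _ _ fun k => ?_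
    rw [c.hm_assoc, hθ]
    ext z
    exact (congrArg Subtype.val z.2.2 : ((z.2 : I) : ℝ) = 0).symm
  let φ : B ⟶ TopCat.of (ULift.{u} ℝ) := c.isPushout.desc O θ w
  have h₁ : i ≫ φ = O := c.isPushout.inl_desc _ _ _
  have h₂ : c.g₂ ≫ φ = θ := c.isPushout.inr_desc _ _ _
  refine ⟨⟨fun b => (φ b : ULift.{u} ℝ).down, continuous_uliftDown.comp φ.hom.continuous⟩,
    fun a => congrArg ULift.down (ConcreteCategory.congr_hom h₁ a), ?_⟩
  refine forall_of_hom_ext _ fun p q h => c.hom_ext ?_ fun k => ?_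
  · ext a
    exact h _ fun _ => ⟨a, rfl⟩
  -- A point of a cell at height `0` lies in its base, which the attaching map sends to `A`.
  · ext z
    refine h _ fun h0 => ?_
    have e : c.cell k ≫ φ = η (c.π k) := by rw [c.cell_def, Category.assoc, h₂, hθ]
    have hz : (z.2 : ℝ) = 0 :=
      (congrArg ULift.down (ConcreteCategory.congr_hom e z)).symm.trans h0
    have e2 : genJ (c.π k) ≫ c.cell k = (c.cofan₁.inj k ≫ c.g₁) ≫ i := by
      rw [c.cell_def, ← c.hm_assoc, Category.assoc, c.isPushout.w]
    have e3 : genJ (c.π k) (z.1, ⟨0, rfl⟩) = z := Prod.ext rfl (Subtype.ext hz.symm)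
    have e4 := ConcreteCategory.congr_hom e2 (z.1, ⟨0, rfl⟩)
    refine ⟨_, e4.symm.trans ?_⟩
    exact congrArg (c.cell k) e3

theorem exists_stageIncl_eq (f : Arrow TopCat.{u}) (w : factObj.obj f) :
    ∃ k, w ∈ Set.range (stageIncl f k) := by
  revert w
  refine forall_of_hom_ext _ fun p q h => colimit.hom_ext fun k => ?_
  ext v
  exact h _ ⟨k, v, rfl⟩

theorem range_stageIncl_mono (f : Arrow TopCat.{u}) :
    Monotone fun k => Set.range (stageIncl f k) := by
  refine monotone_nat_of_le_succ fun k => ?_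
  rintro _ ⟨v, rfl⟩
  exact ⟨stageStep f k v, ConcreteCategory.congr_hom (stageStep_stageIncl f k) v⟩

/-- A sum of functions on the colimit of the stages that is finite on each stage is
continuous. -/
theorem exists_dominating (f : Arrow TopCat.{u}) (ψ : ℕ → C(factObj.obj f, ℝ))
    (hψ : ∀ m, ∀ w ∈ Set.range (stageIncl f m), ψ m w = 0) (h0 : ∀ m w, 0 ≤ ψ m w) :
    ∃ Φ : C(factObj.obj f, ℝ), ∀ m w, ψ m w ≤ Φ w := by
  -- On stage `k` all terms with `m ≥ k` vanish, so these finite sums are compatible.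
  let s (k : ℕ) : (stage f k).left ⟶ TopCat.of (ULift.{u} ℝ) :=
    TopCat.ofHom ⟨fun v => ⟨∑ m ∈ Finset.range k, ψ m (stageIncl f k v)⟩,
      continuous_uliftUp.comp (continuous_finsetSum _ fun m _ =>
        (ψ m).continuous.comp (stageIncl f k).hom.continuous)⟩
  have hs (k : ℕ) : stageStep f k ≫ s (k + 1) = s k := by
    ext v
    have e : stageIncl f (k + 1) (stageStep f k v) = stageIncl f k v :=
      ConcreteCategory.congr_hom (stageStep_stageIncl f k) v
    change ∑ m ∈ Finset.range (k + 1), ψ m (stageIncl f (k + 1) (stageStep f k v)) =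
      ∑ m ∈ Finset.range k, ψ m (stageIncl f k v)
    rw [e, Finset.sum_range_succ, hψ k _ ⟨v, rfl⟩, add_zero]
  let c : Cocone (stageSeq f) :=
    { pt := TopCat.of (ULift.{u} ℝ)
      ι := NatTrans.ofSequence s fun k => by
        rw [stageSeq_map_succ]
        exact (hs k).trans (Category.comp_id _).symm }
  let Φ : factObj.obj f ⟶ TopCat.of (ULift.{u} ℝ) := colimit.desc _ c
  refine ⟨⟨fun w => (Φ w : ULift.{u} ℝ).down, continuous_uliftDown.comp Φ.hom.continuous⟩,
    fun m w => ?_⟩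
  obtain ⟨k, v, rfl⟩ := exists_stageIncl_eq f w
  have e : (Φ (stageIncl f k v) : ULift.{u} ℝ).down =
      ∑ m ∈ Finset.range k, ψ m (stageIncl f k v) :=
    congrArg ULift.down (ConcreteCategory.congr_hom (colimit.ι_desc c k) v)
  refine le_of_le_of_eq ?_ e.symm
  by_cases hm : m < k
  · exact Finset.single_le_sum (f := fun m => ψ m (stageIncl f k v)) (fun m _ => h0 m _)
      (Finset.mem_range.2 hm)
  · rw [hψ m _ (range_stageIncl_mono f (not_lt.1 hm) ⟨v, rfl⟩)]
    exact Finset.sum_nonneg fun m _ => h0 m _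

/-- A map from a compact space to the colimit has image in a stage. -/
theorem exists_range_subset_stage (f : Arrow TopCat.{u}) {K : Type*} [TopologicalSpace K]
    [CompactSpace K] (g : C(K, factObj.obj f)) :
    ∃ k, ∀ x, g x ∈ Set.range (stageIncl f k) := by
  by_contra! hne
  choose φ hφ₀ hφ₁ using fun m => exists_height (stageStepAttachCells f m)
  choose r hr using exists_retraction f
  have hr' (k) (v : (stage f k).left) : r k (stageIncl f k v) = v :=
    ConcreteCategory.congr_hom (hr k) v
  let ψ (m : ℕ) : C(factObj.obj f, ℝ) := (φ m).comp (r (m + 1)).hom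
  have hψ (m) : ∀ w ∈ Set.range (stageIncl f m), ψ m w = 0 := by
    rintro _ ⟨v, rfl⟩
    have e : stageIncl f (m + 1) (stageStep f m v) = stageIncl f m v :=
      ConcreteCategory.congr_hom (stageStep_stageIncl f m) v
    change φ m (r (m + 1) (stageIncl f m v)) = 0
    rw [← e, hr']
    exact hφ₀ m v
  have hex (k : ℕ) : ∃ m, k ≤ m ∧ ∃ x, ψ m (g x) ≠ 0 := by
    classical
    obtain ⟨x, hx⟩ := hne k
    -- Let `m + 1` be the first stage containing `g x`. Vanishing of the height `ψ m` there would
    -- put `g x` in stage `m`.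
    have hfind := Nat.find_spec (exists_stageIncl_eq f (g x))
    have hmin := fun m => Nat.find_min (exists_stageIncl_eq f (g x)) (m := m)
    generalize Nat.find (exists_stageIncl_eq f (g x)) = l at hfind hmin
    have hl : k < l := by
      by_contra hl
      exact hx (range_stageIncl_mono f (not_lt.1 hl) hfind)
    obtain ⟨m, rfl⟩ : ∃ m, l = m + 1 := ⟨l - 1, by omega⟩
    refine ⟨m, by omega, x, fun h => hmin m (by omega) ?_⟩
    obtain ⟨v, hv⟩ := hfind
    change φ m (r (m + 1) (g x)) = 0 at h
    rw [← hv, hr'] at h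
    obtain ⟨v', hv'⟩ := hφ₁ m v h
    refine ⟨v', ?_⟩
    rw [← hv, ← hv']
    exact (ConcreteCategory.congr_hom (stageStep_stageIncl f m) v').symm
  -- The weights make the `m`-th term reach `m` somewhere on the image whenever `ψ m` is not
  -- identically zero there.
  have hN (m : ℕ) : ∃ N : ℝ, 0 ≤ N ∧ ((∃ x, ψ m (g x) ≠ 0) → ∃ x, (m : ℝ) ≤ N * |ψ m (g x)|) := by
    by_cases h : ∃ x, ψ m (g x) ≠ 0
    · obtain ⟨x, hx⟩ := h
      refine ⟨m / |ψ m (g x)|, by positivity, fun _ => ⟨x, ?_⟩⟩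
      rw [div_mul_cancel₀ _ (abs_ne_zero.2 hx)]
    · exact ⟨0, le_rfl, fun h' => absurd h' h⟩
  choose N hN₀ hN using hN
  obtain ⟨Φ, hΦ⟩ := exists_dominating f
    (fun m => ⟨fun w => N m * |ψ m w|, ((ψ m).continuous.abs).const_mul (N m)⟩)
    (fun m w hw => by simp [hψ m w hw]) (fun m w => mul_nonneg (hN₀ m) (abs_nonneg _))
  obtain ⟨B, hB⟩ := (isCompact_range (Φ.comp g).continuous).bddAbove
  obtain ⟨k, hk⟩ := exists_nat_gt B
  obtain ⟨m, hkm, hm⟩ := hex k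
  obtain ⟨x, hx⟩ := hN m hm
  have h1 : N m * |ψ m (g x)| ≤ Φ (g x) := hΦ m (g x)
  have h2 : Φ (g x) ≤ B := hB ⟨x, rfl⟩
  have h3 : (k : ℝ) ≤ m := Nat.cast_le.2 hkm
  linarith

/-! ### The second map of the factorization -/

instance compactSpace_cylBase (n : ℕ) : CompactSpace (cylBase.{u} n) :=
  inferInstanceAs (CompactSpace (TopCat.disk.{u} n × ({0} : Set I)))

/-- Lifting problems for the `k`th stage have a solution in the next stage. -/
theorem exists_stage_lift (f : Arrow TopCat.{u}) (k : ℕ) {n : ℕ}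
    (t : cylBase.{u} n ⟶ (stage f k).left) (b : cyl.{u} n ⟶ f.right)
    (w : t ≫ (stage f k).hom = genJ n ≫ b) :
    ∃ l : cyl.{u} n ⟶ (stage f (k + 1)).left,
      genJ n ≫ l = t ≫ stageStep f k ∧ l ≫ (stage f (k + 1)).hom = b :=
  SmallObject.ιFunctorObj_extension genJ t b ⟨w⟩

theorem hasLiftingProperty_factRight (f : Arrow TopCat.{u}) (n : ℕ) :
    HasLiftingProperty (genJ.{u} n) (factRight.app f) where
  sq_hasLift {t b} sq := by
    obtain ⟨k, hk⟩ := exists_range_subset_stage f t.hom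
    obtain ⟨r, hr⟩ := exists_retraction f k
    -- The retraction supplies a continuous factorization of `t` through stage `k`.
    have ht : (t ≫ r) ≫ stageIncl f k = t := by
      ext z
      obtain ⟨v, hv⟩ := hk z
      have e : r (stageIncl f k v) = v := ConcreteCategory.congr_hom hr v
      change stageIncl f k (r (t.hom z)) = t.hom z
      rw [← hv, e]
    obtain ⟨l, hl₁, hl₂⟩ := exists_stage_lift f k (t ≫ r) b (Eq.trans
      ((congrArg ((t ≫ r) ≫ ·) (stageIncl_factRight f k).symm).trans (Category.assoc _ _ _).symm)
      ((congrArg (· ≫ factRight.app f) ht).trans sq.w))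
    refine ⟨⟨{ l := l ≫ stageIncl f (k + 1), fac_left := ?_, fac_right := ?_ }⟩⟩
    · rw [← Category.assoc, hl₁, Category.assoc, stageStep_stageIncl, ht]
    · exact (Category.assoc _ _ _).trans
        ((congrArg (l ≫ ·) (stageIncl_factRight f (k + 1))).trans hl₂)

/-- Maps with the right lifting property with respect to `J` are Serre fibrations. -/
theorem fibrations_of_hasLiftingProperty {S T : TopCat.{u}} (p : S ⟶ T)
    (hp : ∀ n, HasLiftingProperty (genJ.{u} n) p) : fibrations p := by
  intro n g h hgh
  let t : cylBase.{u} n ⟶ S := TopCat.ofHom (g.comp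
    ⟨fun z : TopCat.disk.{u} n × ({0} : Set I) =>
      (z.1 : ULift (Metric.closedBall (0 : EuclideanSpace ℝ (Fin n)) 1)).down,
      continuous_uliftDown.comp continuous_fst⟩)
  let b : cyl.{u} n ⟶ T := TopCat.ofHom (h.comp
    ⟨fun z : TopCat.disk.{u} n × I =>
      ((z.1 : ULift (Metric.closedBall (0 : EuclideanSpace ℝ (Fin n)) 1)).down, z.2),
      (continuous_uliftDown.comp continuous_fst).prodMk continuous_snd⟩)
  have sq : CommSq t (genJ n) p b := ⟨TopCat.hom_ext (ContinuousMap.ext fun z => by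
    obtain ⟨d, e, he⟩ := z
    obtain rfl : e = 0 := he
    exact (hgh _).symm)⟩
  have := hp n
  let up : C(Metric.closedBall (0 : EuclideanSpace ℝ (Fin n)) 1 × I, cyl.{u} n) :=
    ⟨fun z => ((ULift.up z.1, z.2) :
      ULift (Metric.closedBall (0 : EuclideanSpace ℝ (Fin n)) 1) × I),
      (continuous_uliftUp.comp continuous_fst).prodMk continuous_snd⟩
  refine ⟨sq.lift.hom.comp up, fun d => ?_, fun z => ?_⟩
  · exact ConcreteCategory.congr_hom sq.fac_left
      (((ULift.up d, ⟨0, rfl⟩) :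
        ULift (Metric.closedBall (0 : EuclideanSpace ℝ (Fin n)) 1) × ({0} : Set I)))
  · exact ConcreteCategory.congr_hom sq.fac_right (up z)

/-! ### Relative `J`-cell complexes are relative cell complexes -/

/-- A compact Hausdorff space covered by two compact subspaces is their pushout. -/
theorem isPushout_of_compact {S A D P : TopCat.{u}} {s : S ⟶ A} {b : S ⟶ D} {α : A ⟶ P}
    {δ : D ⟶ P} [CompactSpace A] [CompactSpace D] [T2Space P] (w : s ≫ α = b ≫ δ)
    (hα : Function.Injective α) (hδ : Function.Injective δ)
    (hsurj : ∀ p, p ∈ Set.range α ∨ p ∈ Set.range δ)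
    (hint : ∀ a d, α a = δ d → ∃ x, s x = a ∧ b x = d) : IsPushout s b α δ := by
  let π : C(A ⊕ D, P) := ⟨Sum.elim α δ, α.hom.continuous.sumElim δ.hom.continuous⟩
  -- A continuous surjection from a compact space to a Hausdorff space is a quotient map.
  have hπ : Topology.IsQuotientMap π := by
    refine Topology.IsQuotientMap.of_surjective_continuous (fun p => ?_) π.continuous
    rcases hsurj p with ⟨a, rfl⟩ | ⟨d, rfl⟩
    · exact ⟨Sum.inl a, rfl⟩
    · exact ⟨Sum.inr d, rfl⟩
  let F (c : PushoutCocone s b) : C(A ⊕ D, c.pt) :=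
    ⟨Sum.elim c.inl c.inr, c.inl.hom.continuous.sumElim c.inr.hom.continuous⟩
  have hc (c : PushoutCocone s b) (a : A) (d : D) (h : α a = δ d) : c.inl a = c.inr d := by
    obtain ⟨x, rfl, rfl⟩ := hint a d h
    exact ConcreteCategory.congr_hom c.condition x
  have hF (c : PushoutCocone s b) : Function.FactorsThrough (F c) π := by
    rintro (a | d) (a' | d') h
    · exact congrArg c.inl (hα h)
    · exact hc c a d' h
    · exact (hc c a' d h.symm).symm
    · exact congrArg c.inr (hδ h)
  refine ⟨⟨w⟩, ⟨PushoutCocone.IsColimit.mk _ (fun c => TopCat.ofHom (hπ.lift (F c) (hF c)))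
    (fun c => ?_) (fun c => ?_) (fun c m hl hr => ?_)⟩⟩
  · exact TopCat.hom_ext (ContinuousMap.ext fun a =>
      DFunLike.congr_fun (hπ.lift_comp (F c) (hF c)) (Sum.inl a))
  · exact TopCat.hom_ext (ContinuousMap.ext fun d =>
      DFunLike.congr_fun (hπ.lift_comp (F c) (hF c)) (Sum.inr d))
  · refine TopCat.hom_ext (ContinuousMap.ext fun p => ?_)
    rcases hsurj p with ⟨a, rfl⟩ | ⟨d, rfl⟩
    · exact (ConcreteCategory.congr_hom hl a).trans
        (DFunLike.congr_fun (hπ.lift_comp (F c) (hF c)) (Sum.inl a)).symm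
    · exact (ConcreteCategory.congr_hom hr d).trans
        (DFunLike.congr_fun (hπ.lift_comp (F c) (hF c)) (Sum.inr d)).symm

/-! ### The boundary of the cylinder as base and cap -/

section Geometry

open Metric

variable (n : ℕ)

/-- The solid cylinder `D^n × I` and its boundary correspond to the disk `D^{n+1}` and the
sphere `S^n` under a homeomorphism of the ambient spaces. -/
theorem exists_homeomorph_cylinder :
    ∃ φ : (EuclideanSpace ℝ (Fin n) × ℝ) ≃ₜ EuclideanSpace ℝ (Fin (n + 1)),
      (∀ z, φ z ∈ closedBall 0 1 ↔ ‖z.1‖ ≤ 1 ∧ z.2 ∈ Set.Icc 0 1) ∧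
      ∀ z, φ z ∈ sphere 0 1 ↔
        ‖z.1‖ ≤ 1 ∧ (z.2 = 0 ∨ z.2 = 1) ∨ ‖z.1‖ = 1 ∧ z.2 ∈ Set.Icc 0 1 := by
  let L : (EuclideanSpace ℝ (Fin n) × ℝ) ≃L[ℝ] EuclideanSpace ℝ (Fin (n + 1)) :=
    ContinuousLinearEquiv.ofFinrankEq (by simp)
  let s : Set (EuclideanSpace ℝ (Fin n) × ℝ) := closedBall 0 1 ×ˢ Set.Icc 0 1
  have hs : IsClosed s := isClosed_closedBall.prod isClosed_Icc
  have hfr : frontier s = closedBall 0 1 ×ˢ {0, 1} ∪ sphere 0 1 ×ˢ Set.Icc 0 1 := by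
    rw [frontier_prod_eq, isClosed_closedBall.closure_eq, isClosed_Icc.closure_eq,
      frontier_Icc zero_le_one, frontier_closedBall _ one_ne_zero]
  have hint : (interior s).Nonempty := by
    refine ⟨(0, 1 / 2), ?_⟩
    rw [interior_prod_eq, interior_closedBall _ one_ne_zero, interior_Icc]
    exact ⟨by simp, by norm_num⟩
  have hconv : Convex ℝ (L '' s) :=
    ((convex_closedBall _ _).prod (convex_Icc _ _)).linear_image L.toLinearEquiv.toLinearMap
  have hbdd : Bornology.IsBounded (L '' s) :=
    (((isCompact_closedBall _ _).prod isCompact_Icc).image L.continuous).isBounded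
  have himg : interior (L '' s) = L '' interior s := (L.toHomeomorph.image_interior s).symm
  -- A bounded convex set with nonempty interior is carried to the unit ball by an ambient
  -- homeomorphism that matches closures and frontiers.
  obtain ⟨h, -, hcl, hfront⟩ := exists_homeomorph_image_interior_closure_frontier_eq_unitBall
    hconv (himg ▸ hint.image L) hbdd
  have e1 : closure (L '' s) = L '' s := (L.toHomeomorph.isClosedMap s hs).closure_eq
  have e2 : frontier (L '' s) = L '' frontier s := (L.toHomeomorph.image_frontier s).symm
  let φ := L.toHomeomorph.trans h
  have key (t : Set (EuclideanSpace ℝ (Fin n) × ℝ)) (z) : φ z ∈ h '' (L '' t) ↔ z ∈ t := by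
    rw [← Set.image_comp]
    exact φ.injective.mem_set_image
  refine ⟨φ, fun z => ?_, fun z => ?_⟩
  · rw [← hcl, e1, key]
    simp [s]
  · rw [← hfront, e2, key, hfr]
    simp

variable {n}

/-- The parametrization by the disk `D^n` of the part of the boundary of `D^n × I` that lies
above the base. -/
def capParam (x : EuclideanSpace ℝ (Fin n)) : EuclideanSpace ℝ (Fin n) × ℝ :=
  -- The ball of radius `1/2` is doubled onto the top; the shell outside it covers the side, with
  -- height falling from `1` to `0`.
  ((max (1 / 2) ‖x‖)⁻¹ • x, min 1 (2 - 2 * ‖x‖))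

theorem max_half_norm_pos (x : EuclideanSpace ℝ (Fin n)) : 0 < max (1 / 2) ‖x‖ :=
  lt_max_of_lt_left (by norm_num)

theorem continuous_capParam : Continuous (capParam (n := n)) := by
  have h : Continuous fun x : EuclideanSpace ℝ (Fin n) => (max (1 / 2) ‖x‖)⁻¹ :=
    Continuous.inv₀ (by fun_prop) fun x => (max_half_norm_pos x).ne'
  exact (h.smul continuous_id).prodMk (by fun_prop)

/-- In both regimes `1 - t / 2` is the scaling factor `max (1 / 2) ‖x‖`, so the height `t`
determines how to undo the scaling. This gives injectivity and the preimages in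
`exists_capParam_eq`. -/
theorem capParam_left_inv (x : EuclideanSpace ℝ (Fin n)) :
    (1 - (capParam x).2 / 2) • (capParam x).1 = x := by
  have h : 1 - min 1 (2 - 2 * ‖x‖) / 2 = max (1 / 2) ‖x‖ := by
    rcases le_total (1 / 2) ‖x‖ with h | h
    · rw [min_eq_right (by linarith), max_eq_right h]
      ring
    · rw [min_eq_left (by linarith), max_eq_left h]
      ring
  change (1 - min 1 (2 - 2 * ‖x‖) / 2) • (max (1 / 2) ‖x‖)⁻¹ • x = x
  rw [h, smul_inv_smul₀ (max_half_norm_pos x).ne']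

theorem capParam_mem {x : EuclideanSpace ℝ (Fin n)} (hx : ‖x‖ ≤ 1) :
    ‖(capParam x).1‖ ≤ 1 ∧ ((capParam x).2 = 0 ∨ (capParam x).2 = 1) ∨
      ‖(capParam x).1‖ = 1 ∧ (capParam x).2 ∈ Set.Icc 0 1 := by
  have h1 : ‖(capParam x).1‖ = (max (1 / 2) ‖x‖)⁻¹ * ‖x‖ := by
    change ‖(max (1 / 2) ‖x‖)⁻¹ • x‖ = _
    rw [norm_smul, Real.norm_of_nonneg (inv_nonneg.2 (max_half_norm_pos x).le)]
  have h2 : (capParam x).2 = min 1 (2 - 2 * ‖x‖) := rfl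
  rw [h1, h2]
  rcases le_total (1 / 2) ‖x‖ with h | h
  · right
    rw [min_eq_right (by linarith), max_eq_right h]
    exact ⟨inv_mul_cancel₀ (by linarith), by constructor <;> linarith⟩
  · left
    rw [min_eq_left (by linarith), max_eq_left h]
    exact ⟨by norm_num; linarith, Or.inr rfl⟩

/-- The rim of the cap is glued to the rim of the base by the identity. -/
theorem capParam_of_norm_eq_one {x : EuclideanSpace ℝ (Fin n)} (hx : ‖x‖ = 1) :
    capParam x = (x, 0) := by
  have h : max (1 / 2 : ℝ) 1 = 1 := by norm_num
  simp [capParam, hx]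
  norm_num [h]

theorem exists_capParam_eq {z : EuclideanSpace ℝ (Fin n) × ℝ}
    (hz : ‖z.1‖ ≤ 1 ∧ z.2 = 1 ∨ ‖z.1‖ = 1 ∧ z.2 ∈ Set.Icc 0 1) :
    ∃ x, ‖x‖ ≤ 1 ∧ capParam x = z := by
  obtain ⟨y, t⟩ := z
  refine ⟨(1 - t / 2) • y, ?_⟩
  rcases hz with ⟨hy, ht⟩ | ⟨hy, ht0, ht1⟩
  · dsimp only at hy ht
    subst ht
    have hn : ‖(1 - 1 / 2 : ℝ) • y‖ = 1 / 2 * ‖y‖ := by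
      rw [norm_smul]; norm_num
    refine ⟨by rw [hn]; linarith, ?_⟩
    rw [capParam, hn, max_eq_left (by linarith), min_eq_left (by linarith), smul_smul]
    norm_num
  · dsimp only at hy ht0 ht1
    have hn : ‖(1 - t / 2) • y‖ = 1 - t / 2 := by
      rw [norm_smul, hy, mul_one, Real.norm_of_nonneg (by linarith)]
    refine ⟨by rw [hn]; linarith, ?_⟩
    rw [capParam, hn, max_eq_right (by linarith), min_eq_right (by linarith),
      inv_smul_smul₀ (by linarith)]
    exact Prod.ext rfl (by ring)

end Geometry

/-- The inclusion of the sphere `S^{n-1}` into the base of the cylinder `D^n × I`. -/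
def sphereToBase (n : ℕ) : TopCat.diskBoundary.{u} n ⟶ cylBase.{u} n :=
  TopCat.ofHom ⟨fun x => (genI n x, ⟨0, rfl⟩),
    (genI n).hom.continuous.prodMk continuous_const⟩

/-- The generating trivial cofibration `D^n × {0} ⟶ D^n × I` is the composition of a pushout of
`S^{n-1} ⟶ D^n` and a map isomorphic to `S^n ⟶ D^{n+1}`. -/
theorem exists_genJ_factorization (n : ℕ) :
    ∃ (p : cylBase.{u} n ⟶ TopCat.diskBoundary.{u} (n + 1))
      (d : TopCat.disk.{u} n ⟶ TopCat.diskBoundary.{u} (n + 1))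
      (Φ : TopCat.disk.{u} (n + 1) ≅ cyl.{u} n),
      IsPushout (sphereToBase n) (genI n) p d ∧ p ≫ genI (n + 1) ≫ Φ.hom = genJ n := by
  obtain ⟨φ, hφ, hφ'⟩ := exists_homeomorph_cylinder n
  let S := Metric.sphere (0 : EuclideanSpace ℝ (Fin (n + 1))) 1
  let D := Metric.closedBall (0 : EuclideanSpace ℝ (Fin n)) 1
  let D' := Metric.closedBall (0 : EuclideanSpace ℝ (Fin (n + 1))) 1
  have hD (x : D) : ‖x.1‖ ≤ 1 := mem_closedBall_zero_iff.1 x.2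
  let p : cylBase.{u} n ⟶ TopCat.diskBoundary.{u} (n + 1) := TopCat.ofHom
    (X := ULift.{u} D × ({0} : Set I)) (Y := ULift.{u} S)
    ⟨fun z => ⟨φ (z.1.down.1, 0), (hφ' _).2 (Or.inl ⟨hD _, Or.inl rfl⟩)⟩, by fun_prop⟩
  let d : TopCat.disk.{u} n ⟶ TopCat.diskBoundary.{u} (n + 1) := TopCat.ofHom
    (X := ULift.{u} D) (Y := ULift.{u} S)
    ⟨fun x => ⟨φ (capParam x.down.1), (hφ' _).2 (capParam_mem (hD _))⟩,
      continuous_uliftUp.comp (Continuous.subtype_mk (φ.continuous.comp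
        (continuous_capParam.comp (continuous_subtype_val.comp continuous_uliftDown))) _)⟩
  have hΦ (y : D') : ‖(φ.symm y.1).1‖ ≤ 1 ∧ (φ.symm y.1).2 ∈ Set.Icc (0 : ℝ) 1 :=
    (hφ _).1 (by rw [φ.apply_symm_apply]; exact y.2)
  let Φ : TopCat.disk.{u} (n + 1) ≅ cyl.{u} n :=
    { hom := TopCat.ofHom (X := ULift.{u} D') (Y := ULift.{u} D × I)
        ⟨fun y => (⟨⟨(φ.symm y.down.1).1, mem_closedBall_zero_iff.2 (hΦ y.down).1⟩⟩,
          ⟨(φ.symm y.down.1).2, (hΦ y.down).2⟩), by fun_prop⟩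
      inv := TopCat.ofHom (X := ULift.{u} D × I) (Y := ULift.{u} D')
        ⟨fun z => ⟨φ (z.1.down.1, z.2.1), (hφ _).2 ⟨hD _, z.2.2⟩⟩, by fun_prop⟩
      hom_inv_id := TopCat.hom_ext (ContinuousMap.ext fun y : ULift.{u} D' =>
        congrArg ULift.up (Subtype.ext (φ.apply_symm_apply y.down.1)))
      inv_hom_id := TopCat.hom_ext (ContinuousMap.ext fun z : ULift.{u} D × I => by
        have e := φ.symm_apply_apply (z.1.down.1, z.2.1)
        exact Prod.ext (congrArg ULift.up (Subtype.ext (congrArg Prod.fst e)))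
          (Subtype.ext (congrArg Prod.snd e))) }
  refine ⟨p, d, Φ, ?_, ?_⟩
  · have hp (z : ULift.{u} D × ({0} : Set I)) (y : ULift.{u} S) (h : φ (z.1.down.1, 0) = y.down.1) :
        p z = y := congrArg ULift.up (Subtype.ext h)
    have : T2Space (TopCat.diskBoundary.{u} (n + 1)) := inferInstanceAs (T2Space (ULift.{u} S))
    have val_eq {y y' : ULift.{u} S} (h : y = y') : y.down.1 = y'.down.1 :=
      congrArg (fun y => y.down.1) h
    -- `S^n` is the union of base and cap, which meet exactly in `S^{n-1}`.
    refine isPushout_of_compact ?_ ?_ ?_ ?_ ?_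
    · refine TopCat.hom_ext (ContinuousMap.ext fun x => ?_)
      refine congrArg ULift.up (Subtype.ext (congrArg φ ?_))
      have hx : ‖(ULift.down x).1‖ = 1 := mem_sphere_zero_iff_norm.1 (ULift.down x).2
      exact (capParam_of_norm_eq_one hx).symm
    · rintro ⟨x, e, rfl⟩ ⟨x', e', rfl⟩ h
      have h' : x.down.1 = x'.down.1 := congrArg Prod.fst (φ.injective (val_eq h))
      exact Prod.ext (ULift.ext _ _ (Subtype.ext h')) rfl
    · intro x x' h
      have h' : capParam (ULift.down x).1 = capParam (ULift.down x').1 :=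
        φ.injective (val_eq h)
      refine ULift.ext _ _ (Subtype.ext ?_)
      rw [← capParam_left_inv (ULift.down x).1, h', capParam_left_inv]
    · intro y
      have hy := (hφ' (φ.symm (ULift.down y).1)).1 (by
        rw [φ.apply_symm_apply]; exact (ULift.down y).2)
      by_cases h0 : (φ.symm (ULift.down y).1).2 = 0
      · left
        have hle : ‖(φ.symm (ULift.down y).1).1‖ ≤ 1 := by
          rcases hy with ⟨h, -⟩ | ⟨h, -⟩
          exacts [h, h.le]
        refine ⟨(⟨⟨_, mem_closedBall_zero_iff.2 hle⟩⟩, ⟨0, rfl⟩), hp _ _ ?_⟩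
        rw [← h0]
        exact φ.apply_symm_apply _
      · right
        obtain ⟨x, hx, hxy⟩ := exists_capParam_eq (z := φ.symm (ULift.down y).1) (by
          rcases hy with ⟨h, h' | h'⟩ | h
          exacts [absurd h' h0, Or.inl ⟨h, h'⟩, Or.inr h])
        refine ⟨⟨⟨x, mem_closedBall_zero_iff.2 hx⟩⟩, congrArg ULift.up (Subtype.ext ?_)⟩
        change φ (capParam x) = _
        rw [hxy]
        exact φ.apply_symm_apply _
    · rintro ⟨a, e, rfl⟩ x h
      have h' : (a.down.1, (0 : ℝ)) = capParam (ULift.down x).1 := φ.injective (val_eq h)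
      have hx : ‖(ULift.down x).1‖ = 1 := by
        have h2 : 0 = min 1 (2 - 2 * ‖(ULift.down x).1‖) := congrArg Prod.snd h'
        rcases min_choice 1 (2 - 2 * ‖(ULift.down x).1‖) with h3 | h3
        · rw [h3] at h2
          exact absurd h2 zero_ne_one
        · rw [h3] at h2
          linarith
      rw [capParam_of_norm_eq_one hx] at h'
      refine ⟨⟨⟨(ULift.down x).1, mem_sphere_zero_iff_norm.2 hx⟩⟩, ?_, rfl⟩
      exact Prod.ext (ULift.ext _ _ (Subtype.ext (congrArg Prod.fst h').symm)) rfl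
  · refine TopCat.hom_ext (ContinuousMap.ext fun z => ?_)
    obtain ⟨x, e, rfl⟩ := z
    have e := φ.symm_apply_apply (x.down.1, (0 : ℝ))
    exact Prod.ext (congrArg ULift.up (Subtype.ext (congrArg Prod.fst e)))
      (Subtype.ext (congrArg Prod.snd e))

/-- A map that attaches cells `D^n × I` along `D^n × {0}` is a composition of two maps that attach
cells `D^n` along `S^{n-1}`. -/
theorem exists_attachCells_genI {A B : TopCat.{u}} {i : A ⟶ B} (c : AttachCells.{u} genJ i) :
    ∃ (Z : TopCat.{u}) (f₁ : A ⟶ Z) (f₂ : Z ⟶ B), f₁ ≫ f₂ = i ∧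
      Nonempty (AttachCells.{u} genI f₁) ∧ Nonempty (AttachCells.{u} genI f₂) := by
  choose p d Φ sq hp using exists_genJ_factorization.{u}
  have e : genJ.{u} = fun n => p n ≫ genI (n + 1) ≫ (Φ n).hom := funext fun n => (hp n).symm
  rw [e] at c
  obtain ⟨Z, f₁, f₂, hf, h₁, ⟨h₂⟩⟩ :=
    c.exists_factorization sq (fun n => genI (n + 1) ≫ (Φ n).hom)
  -- The second cells are disks of dimension `n + 1` up to `Φ n`, whence the shift of index.
  refine ⟨Z, f₁, f₂, hf, h₁, ⟨h₂.reindexCellTypes genI (· + 1) fun n => ?_⟩⟩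
  exact Arrow.isoMk (Iso.refl _) (Φ n).symm

theorem relativeCellComplexes_factLeft (f : Arrow TopCat.{u}) :
    relativeCellComplexes (factLeft.app f) := by
  choose Z f₁ f₂ hf h₁ h₂ using fun k => exists_attachCells_genI (stageStepAttachCells f k)
  exact ⟨isEmbedding_stageIncl f 0, _, _, _, _, _,
    ⟨relativeCellComplexOfFactoredSequence (F := stageSeq f) f₁ f₂
      (fun k => (hf k).trans (stageSeq_map_succ f k).symm) genI (colimit.isColimit (stageSeq f))
      (fun k => (h₁ k).some) (fun k => (h₂ k).some)⟩⟩

end QuillenTop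

end

/-- Let `X ⟶ W ⟶ Y` be the functorial `J`-factorization of a map `f : X ⟶ Y` of topological
spaces. It is a factorization of `f` into a relative `J`-cell complex followed by a map with the
right lifting property with respect to `J`; the first map is a relative cell complex, hence
a cofibration, and it is a weak homotopy equivalence; the second map is a Serre fibration. -/
theorem proposition5p2 {X Y : TopCat.{u}} (f : X ⟶ Y) :
    QuillenTop.factLeft.app (Arrow.mk f) ≫ QuillenTop.factRight.app (Arrow.mk f) = f ∧
    QuillenTop.relativeJCellComplexes (QuillenTop.factLeft.app (Arrow.mk f)) ∧
    (∀ n : ℕ, HasLiftingProperty (QuillenTop.genJ.{u} n)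
      (QuillenTop.factRight.app (Arrow.mk f))) ∧
    QuillenTop.relativeCellComplexes (QuillenTop.factLeft.app (Arrow.mk f)) ∧
    QuillenTop.cofibrations (QuillenTop.factLeft.app (Arrow.mk f)) ∧
    QuillenTop.weakEquivalences (QuillenTop.factLeft.app (Arrow.mk f)) ∧
    QuillenTop.fibrations (QuillenTop.factRight.app (Arrow.mk f)) := by
  have hI := QuillenTop.relativeCellComplexes_factLeft (Arrow.mk f)
  have hq := QuillenTop.hasLiftingProperty_factRight (Arrow.mk f)
  exact ⟨QuillenTop.stageIncl_factRight (Arrow.mk f) 0,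
    QuillenTop.relativeJCellComplexes_factLeft (Arrow.mk f), hq, hI,
    MorphismProperty.le_retracts _ _ hI, QuillenTop.weakEquivalences_factLeft (Arrow.mk f),
    QuillenTop.fibrations_of_hasLiftingProperty _ hq⟩
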